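/- Let $H$ be a complex Hilbert space and $T$ a bounded linear operator on $H$. Let $\|\cdot\|$ be the operator norm and let $w(T)=\sup\{|\langle Tx,x\rangle| : x\in H,\ \|x\|=1\}$ be the numerical radius of $T$ (with $w(T)=0$ if $H=\{0\}$). Then $$w^2(T)\le \frac12\left[\|T^2\|^{1/2}\left(\frac12\|T\|+\frac12\|T^2\|^{1/2}\right)+\frac12\|T^*T+TT^*\|\right].$$ This improves Kittaneh's bound $w(T)\le\frac12\left(\|T\|+\|T^2\|^{1/2}\right)$: for every $H$ and $T$ as above, $$\frac12\left[\|T^2\|^{1/2}\left(\frac12\|T\|+\frac12\|T^2\|^{1/2}\right)+\frac12\|T^*T+TT^*\|\right]\le\left(\frac12\left(\|T\|+\|T^2\|^{1/2}\right)\right)^2,$$ and there is an operator $T$ on the Euclidean space $\mathbb{C}^2$ for which the latter inequality is strict. -/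

import Mathlib

/-- The numerical range `W(T) = {⟨Tx, x⟩ : ‖x‖ = 1}`. Mathlib's inner product is linear in its
second argument, so `⟨Tx, x⟩`, linear in the first, is `inner ℂ x (T x)`. -/
def numericalRange {H : Type*} [NormedAddCommGroup H] [InnerProductSpace ℂ H]
    (T : H →L[ℂ] H) : Set ℂ :=
  {z | ∃ x : H, ‖x‖ = 1 ∧ z = inner ℂ x (T x)}

/-- The numerical radius `w(T) = sup {|z| : z ∈ W(T)}` (it is `0` on the zero space, where the
numerical range is empty). -/
noncomputable def numericalRadius {H : Type*} [NormedAddCommGroup H] [InnerProductSpace ℂ H]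
    (T : H →L[ℂ] H) : ℝ :=
  sSup ((fun z : ℂ => ‖z‖) '' numericalRange T)

/-- The supremum in `numericalRadius` is over a bounded set. -/
theorem numericalRange_bddAbove {H : Type*} [NormedAddCommGroup H] [InnerProductSpace ℂ H]
    (T : H →L[ℂ] H) : BddAbove ((fun z : ℂ => ‖z‖) '' numericalRange T) := by
  refine ⟨‖T‖, ?_⟩
  rintro _ ⟨z, ⟨x, hx, rfl⟩, rfl⟩
  have h1 := norm_inner_le_norm (𝕜 := ℂ) x (T x)
  have h2 := T.le_opNorm x
  rw [hx] at h1 h2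
  simpa using h1.trans (by simpa using h2)

/-- The upper bound
`½ [‖T²‖^{1/2} (½‖T‖ + ½‖T²‖^{1/2}) + ½ ‖T*T + TT*‖]` for the square of the numerical radius. -/
noncomputable def radiusSqBound {H : Type*} [NormedAddCommGroup H] [InnerProductSpace ℂ H]
    [CompleteSpace H] (T : H →L[ℂ] H) : ℝ :=
  (1 / 2 : ℝ) *
    (Real.sqrt ‖T ^ 2‖ * ((1 / 2 : ℝ) * ‖T‖ + (1 / 2 : ℝ) * Real.sqrt ‖T ^ 2‖)
      + (1 / 2 : ℝ) *
        ‖ContinuousLinearMap.adjoint T * T + T * ContinuousLinearMap.adjoint T‖)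

/-- Kittaneh's upper bound `½ (‖T‖ + ‖T²‖^{1/2})` for the numerical radius. -/
noncomputable def kittanehBound {H : Type*} [NormedAddCommGroup H] [InnerProductSpace ℂ H]
    (T : H →L[ℂ] H) : ℝ :=
  (1 / 2 : ℝ) * (‖T‖ + Real.sqrt ‖T ^ 2‖)

/-! For a unit vector `x`, choose a unimodular `c` with `c⟨Tx, x⟩ = |⟨Tx, x⟩|`. Then `2|⟨Tx, x⟩| ≤
‖cTx + c̄T*x‖`, and the cross term of the squared norm is controlled by `⟨T²x, x⟩`. Hence `w²(T) ≤
½‖T²‖ + ¼‖T*T + TT*‖`, which implies the stated bound because `s := ‖T²‖^{1/2} ≤ ‖T‖`. Inserting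
`‖T*T + TT*‖ ≤ ‖T‖² + ‖T²‖` shows that Kittaneh's bound squared is larger by at least `¼s(‖T‖ - s)`,
which is positive for an idempotent of norm above one. -/

section NumericalRadius

variable {H : Type*} [NormedAddCommGroup H] [InnerProductSpace ℂ H]

open ContinuousLinearMap

/-- `‖T²‖^{1/2} ≤ ‖T‖`. -/
theorem sqrt_norm_sq_le (T : H →L[ℂ] H) : Real.sqrt ‖T ^ 2‖ ≤ ‖T‖ := by
  rw [Real.sqrt_le_left (norm_nonneg _), pow_two, pow_two]
  exact norm_mul_le T T

theorem numericalRadius_nonneg (T : H →L[ℂ] H) : 0 ≤ numericalRadius T := by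
  apply Real.sSup_nonneg
  rintro _ ⟨z, -, rfl⟩
  exact norm_nonneg z

theorem numericalRadius_sq_le_of_forall {T : H →L[ℂ] H} {M : ℝ} (hM : 0 ≤ M)
    (h : ∀ x : H, ‖x‖ = 1 → ‖inner ℂ x (T x)‖ ^ 2 ≤ M) : numericalRadius T ^ 2 ≤ M := by
  rw [← Real.le_sqrt (numericalRadius_nonneg T) hM]
  apply Real.sSup_le _ (Real.sqrt_nonneg _)
  rintro _ ⟨z, ⟨x, hx, rfl⟩, rfl⟩
  exact Real.le_sqrt_of_sq_le (h x hx)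

/-- `‖u + v‖² ≤ ‖u‖² + ‖v‖² + 2 |⟨u, v⟩|`. -/
theorem norm_add_sq_le_add_norm_inner (u v : H) :
    ‖u + v‖ ^ 2 ≤ ‖u‖ ^ 2 + ‖v‖ ^ 2 + 2 * ‖inner ℂ u v‖ := by
  have h1 := norm_add_sq (𝕜 := ℂ) u v
  have h2 : RCLike.re (inner ℂ u v) ≤ ‖inner ℂ u v‖ := RCLike.re_le_norm _
  linarith

theorem norm_sq_apply_le (T : H →L[ℂ] H) (x : H) : ‖T x‖ ^ 2 ≤ ‖T‖ ^ 2 * ‖x‖ ^ 2 := by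
  rw [← mul_pow]
  exact pow_le_pow_left₀ (norm_nonneg _) (T.le_opNorm x) 2

variable [CompleteSpace H]

/-- `‖Tx‖² + ‖T*x‖² = ⟨(T*T + TT*)x, x⟩ ≤ ‖T*T + TT*‖ ‖x‖²`. -/
theorem norm_sq_apply_add_norm_sq_adjoint_apply_le (T : H →L[ℂ] H) (x : H) :
    ‖T x‖ ^ 2 + ‖adjoint T x‖ ^ 2 ≤ ‖adjoint T * T + T * adjoint T‖ * ‖x‖ ^ 2 := by
  set P := adjoint T * T + T * adjoint T with hP
  have h1 : inner ℂ x (P x) = ((‖T x‖ ^ 2 + ‖adjoint T x‖ ^ 2 : ℝ) : ℂ) := by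
    simp only [hP, add_apply, mul_apply_eq_comp, inner_add_right, adjoint_inner_right]
    rw [← adjoint_inner_left T (adjoint T x) x, inner_self_eq_norm_sq_to_K, inner_self_eq_norm_sq_to_K]
    push_cast
    rfl
  have h2 : ‖inner ℂ x (P x)‖ ≤ ‖x‖ * (‖P‖ * ‖x‖) :=
    (norm_inner_le_norm x (P x)).trans (by gcongr; exact P.le_opNorm x)
  rw [h1, Complex.norm_real, Real.norm_of_nonneg (by positivity)] at h2
  linarith

/-- Kittaneh's estimate `‖T*T + TT*‖ ≤ ‖T‖² + ‖T²‖`. -/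
theorem norm_adjoint_mul_self_add_le (T : H →L[ℂ] H) :
    ‖adjoint T * T + T * adjoint T‖ ≤ ‖T‖ ^ 2 + ‖T ^ 2‖ := by
  set P := adjoint T * T + T * adjoint T with hP
  set K := ‖T‖ ^ 2 + ‖T ^ 2‖ with hK
  have hK0 : 0 ≤ K := by positivity
  -- In `‖T*u + Tv‖²` the cross term is `⟨u, T²v⟩`; `h6` is the AM-GM step that absorbs `2‖u‖‖v‖`
  -- into `‖u‖² + ‖v‖²`.
  have key (x : H) : ‖P x‖ ^ 2 ≤ K * ‖P‖ * ‖x‖ ^ 2 := by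
    have hPx : P x = adjoint T (T x) + T (adjoint T x) := rfl
    set u := T x with hu
    set v := adjoint T x with hv
    have h1 := norm_add_sq_le_add_norm_inner (adjoint T u) (T v)
    have h2 := norm_sq_apply_le (adjoint T) u
    rw [LinearIsometryEquiv.norm_map] at h2
    have h3 := norm_sq_apply_le T v
    have h4 : ‖inner ℂ (adjoint T u) (T v)‖ ≤ ‖u‖ * (‖T ^ 2‖ * ‖v‖) := by
      rw [adjoint_inner_left]
      exact (norm_inner_le_norm (𝕜 := ℂ) u ((T ^ 2) v)).trans
        (mul_le_mul_of_nonneg_left ((T ^ 2).le_opNorm v) (norm_nonneg u))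
    have h5 : ‖u‖ ^ 2 + ‖v‖ ^ 2 ≤ ‖P‖ * ‖x‖ ^ 2 :=
      norm_sq_apply_add_norm_sq_adjoint_apply_le T x
    have h6 := mul_nonneg (norm_nonneg (T ^ 2)) (sq_nonneg (‖u‖ - ‖v‖))
    have h7 := mul_le_mul_of_nonneg_left h5 hK0
    rw [hPx]
    linarith
  -- The estimate is self-bounding: `‖P‖² ≤ K‖P‖`, so one factor cancels unless `‖P‖ = 0`.
  have h8 : ‖P‖ ≤ Real.sqrt (K * ‖P‖) := by
    refine P.opNorm_le_bound (Real.sqrt_nonneg _) fun x => ?_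
    rw [← Real.sqrt_sq (norm_nonneg x), ← Real.sqrt_mul (by positivity)]
    exact Real.le_sqrt_of_sq_le (by simpa using key x)
  rcases (norm_nonneg P).eq_or_lt with h | h
  · rw [← h]; exact hK0
  · have h9 := (Real.le_sqrt h.le (by positivity)).1 h8
    rw [pow_two] at h9
    exact le_of_mul_le_mul_right h9 h

/-- The pointwise form of `w²(T) ≤ ½‖T²‖ + ¼‖T*T + TT*‖`. -/
theorem norm_inner_apply_sq_le (T : H →L[ℂ] H) {x : H} (hx : ‖x‖ = 1) :
    ‖inner ℂ x (T x)‖ ^ 2 ≤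
      (1 / 2) * ‖T ^ 2‖ + (1 / 4) * ‖adjoint T * T + T * adjoint T‖ := by
  set z : ℂ := inner ℂ x (T x) with hz
  obtain ⟨c, hc, hcz⟩ : ∃ c : ℂ, ‖c‖ = 1 ∧ ((‖z‖ : ℝ) : ℂ) = c * z :=
    RCLike.exists_norm_eq_mul_self z
  set u := c • T x with hu
  set v := (starRingEnd ℂ) c • adjoint T x with hv
  have hux : inner ℂ x u = ((‖z‖ : ℝ) : ℂ) := by rw [hu, inner_smul_right, ← hz, hcz]
  have hvx : inner ℂ x v = ((‖z‖ : ℝ) : ℂ) := by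
    rw [hv, inner_smul_right, adjoint_inner_right, ← inner_conj_symm, ← hz, ← map_mul, ← hcz,
      Complex.conj_ofReal]
  have h1 : 2 * ‖z‖ ≤ ‖u + v‖ := by
    have h := norm_inner_le_norm (𝕜 := ℂ) x (u + v)
    rw [inner_add_right, hux, hvx, ← Complex.ofReal_add, Complex.norm_real,
      Real.norm_of_nonneg (by positivity), hx] at h
    linarith
  have h2 := norm_add_sq_le_add_norm_inner v u
  -- The two scalars combine to `c²`, of modulus one, leaving `⟨T*x, Tx⟩`, where moving the adjoint
  -- produces `T²`.
  have h3 : ‖inner ℂ v u‖ ≤ ‖T ^ 2‖ := by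
    rw [hu, hv, inner_smul_left, inner_smul_right, adjoint_inner_left]
    have h := (norm_inner_le_norm (𝕜 := ℂ) x ((T ^ 2) x)).trans
      (mul_le_mul_of_nonneg_left ((T ^ 2).le_opNorm x) (norm_nonneg x))
    rw [hx, one_mul, mul_one] at h
    simpa [hc] using h
  have hnu : ‖u‖ = ‖T x‖ := by rw [hu, norm_smul, hc, one_mul]
  have hnv : ‖v‖ = ‖adjoint T x‖ := by rw [hv, norm_smul, RCLike.norm_conj, hc, one_mul]
  have h4 := norm_sq_apply_add_norm_sq_adjoint_apply_le T x
  rw [hx, ← hnu, ← hnv] at h4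
  have h5 := pow_le_pow_left₀ (by positivity) h1 2
  rw [add_comm u v] at h5
  linarith

theorem numericalRadius_sq_le_radiusSqBound (T : H →L[ℂ] H) :
    numericalRadius T ^ 2 ≤ radiusSqBound T := by
  have h : numericalRadius T ^ 2 ≤
      (1 / 2) * ‖T ^ 2‖ + (1 / 4) * ‖adjoint T * T + T * adjoint T‖ :=
    numericalRadius_sq_le_of_forall (by positivity) fun x hx => norm_inner_apply_sq_le T hx
  have h1 := mul_le_mul_of_nonneg_left (sqrt_norm_sq_le T) (Real.sqrt_nonneg ‖T ^ 2‖)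
  have h2 := Real.mul_self_sqrt (norm_nonneg (T ^ 2))
  unfold radiusSqBound
  linarith

/-- The gap between the square of Kittaneh's bound and `radiusSqBound`. -/
theorem radiusSqBound_add_le_kittanehBound_sq (T : H →L[ℂ] H) :
    radiusSqBound T + (1 / 4) * (Real.sqrt ‖T ^ 2‖ * (‖T‖ - Real.sqrt ‖T ^ 2‖)) ≤
      kittanehBound T ^ 2 := by
  have h1 := norm_adjoint_mul_self_add_le T
  have h2 := Real.mul_self_sqrt (norm_nonneg (T ^ 2))
  unfold radiusSqBound kittanehBound
  linarith

theorem radiusSqBound_le_kittanehBound_sq (T : H →L[ℂ] H) :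
    radiusSqBound T ≤ kittanehBound T ^ 2 := by
  have h1 := radiusSqBound_add_le_kittanehBound_sq T
  have h2 := mul_nonneg (Real.sqrt_nonneg ‖T ^ 2‖) (sub_nonneg.2 (sqrt_norm_sq_le T))
  linarith

/-- The inequality is strict for every idempotent of norm larger than one. -/
theorem radiusSqBound_lt_kittanehBound_sq_of_idempotent {T : H →L[ℂ] H} (hT : T ^ 2 = T)
    (h1 : 1 < ‖T‖) : radiusSqBound T < kittanehBound T ^ 2 := by
  have h2 := radiusSqBound_add_le_kittanehBound_sq T
  rw [hT] at h2
  -- Since `T² = T`, the gap is now `¼√‖T‖(‖T‖ - √‖T‖)`.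
  have h3 : Real.sqrt ‖T‖ < ‖T‖ := by
    rw [Real.sqrt_lt' (by linarith)]
    nlinarith
  have h4 := mul_pos (Real.sqrt_pos.2 (by linarith : 0 < ‖T‖)) (sub_pos.2 h3)
  linarith

end NumericalRadius

/-- The oblique projection `(x₀, x₁) ↦ (x₀ + x₁, 0)` of `ℂ²` onto the first axis. -/
theorem exists_idempotent_one_lt_norm :
    ∃ T : EuclideanSpace ℂ (Fin 2) →L[ℂ] EuclideanSpace ℂ (Fin 2), T ^ 2 = T ∧ 1 < ‖T‖ := by
  let a : EuclideanSpace ℂ (Fin 2) := !₂[1, 1]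
  let b : EuclideanSpace ℂ (Fin 2) := !₂[1, 0]
  have hab : inner ℂ a b = 1 := by
    simp [a, b, PiLp.inner_apply, Fin.sum_univ_two]
  have hb : ‖b‖ = 1 := by simp [b, EuclideanSpace.norm_eq, Fin.sum_univ_two]
  have ha : 1 < ‖a‖ := by
    simp only [a, EuclideanSpace.norm_eq, Fin.sum_univ_two]
    rw [Real.lt_sqrt zero_le_one]
    norm_num
  -- The map `x ↦ ⟨a, x⟩b` is idempotent because `⟨a, b⟩ = 1`, and its norm is `‖a‖‖b‖ = √2`.
  refine ⟨InnerProductSpace.rankOne ℂ b a, ?_, ?_⟩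
  · ext1 x
    simp [pow_two, hab]
  · simpa [InnerProductSpace.norm_rankOne, hb] using ha

theorem mainTheorem6 :
    (∀ (H : Type*) [NormedAddCommGroup H] [InnerProductSpace ℂ H] [CompleteSpace H]
      (T : H →L[ℂ] H),
      numericalRadius T ^ 2 ≤ radiusSqBound T ∧ radiusSqBound T ≤ kittanehBound T ^ 2) ∧
    (∃ T : EuclideanSpace ℂ (Fin 2) →L[ℂ] EuclideanSpace ℂ (Fin 2),
      radiusSqBound T < kittanehBound T ^ 2) := by
  refine ⟨fun H _ _ _ T =>
    ⟨numericalRadius_sq_le_radiusSqBound T, radiusSqBound_le_kittanehBound_sq T⟩, ?_⟩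
  obtain ⟨T, hT, h1⟩ := exists_idempotent_one_lt_norm
  exact ⟨T, radiusSqBound_lt_kittanehBound_sq_of_idempotent hT h1⟩
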